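/- Let $p$ be a prime, $K$ a finite field extension of $\mathbb{Q}_p$, $v:K^\times\to\mathbb{Z}$ its normalized (surjective) valuation extending the $p$-adic valuation up to scaling, $R=\{x\in K : x=0 \text{ or } v(x)\ge 0\}$ its valuation ring, and $\pi\in K$ an element with $v(\pi)=1$. Let $\mathcal{L}_\pi$ be the language of rings with an extra constant symbol, interpreted in $K$ as $\pi$. Let $A\subseteq K$ be any set, possibly empty, and let "definable" mean definable by a first-order $\mathcal{L}_\pi$-formula with parameters from $A$ (for $A=\emptyset$: without parameters). Call definable sets $X\subseteq K^m$ and $Y\subseteq K^n$ ($m,n\ge 1$) isomorphic if there is a bijection $X\to Y$ whose graph is a definable subset of $K^{m+n}$. Let $F$ be the free abelian group on the isomorphism classes $\lfloor X\rfloor$ of definable sets $X\subseteq K^n$, $n\geq 1$, and let $E\subseteq F$ be the subgroup generated by $\lfloor\emptyset\rfloor$ and by all $\lfloor X\rfloor+\lfloor Y\rfloor-\lfloor X\cup Y\rfloor-\lfloor X\cap Y\rfloor$ with $X,Y\subseteq K^n$ definable, $n\ge 1$. The Grothendieck ring $K_0(K)$ is the group $F/E$ with the multiplication induced by $\lfloor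 X\rfloor\cdot\lfloor Y\rfloor=\lfloor X\times Y\rfloor$. Theorem. $K_0(K)=0$, and there is a definable bijection from $R$ to $R\setminus\{0\}$. -/

import Mathlib

open scoped FirstOrder

universe u v w

namespace DefinableGrothendieck

section General

variable {M : Type w} (L : FirstOrder.Language.{u, v}) [L.Structure M] (A : Set M)

/-- `X ⊆ M^m` and `Y ⊆ M^n` are isomorphic: there is a bijection `X → Y` whose graph, as a subset
of `M^(m+n)`, is definable in `L` with parameters from `A`. -/
def DefIso {m n : ℕ} (X : Set (Fin m → M)) (Y : Set (Fin n → M)) : Prop :=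
  ∃ f : X ≃ Y, A.Definable L
    {z : Fin m ⊕ Fin n → M | ∃ x : X, z ∘ Sum.inl = (x : Fin m → M) ∧
      z ∘ Sum.inr = (f x : Fin n → M)}

/-- The cartesian product of `X ⊆ M^m` and `Y ⊆ M^n`, as a subset of `M^(m+n)`. -/
def prodSet {m n : ℕ} (X : Set (Fin m → M)) (Y : Set (Fin n → M)) : Set (Fin (m + n) → M) :=
  {z | z ∘ Fin.castAdd n ∈ X ∧ z ∘ Fin.natAdd m ∈ Y}

/-- The definable subsets (over the parameters `A`) of `M^n`, for all positive integers `n`. -/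
structure DefSet where
  dim : ℕ
  dim_pos : 0 < dim
  carrier : Set (Fin dim → M)
  definable : A.Definable L carrier

variable {L A}

theorem definable_eq {α : Type*} (i j : α) : A.Definable L {z : α → M | z i = z j} :=
  ⟨(FirstOrder.Language.var i).equal (FirstOrder.Language.var j), by ext; simp⟩

theorem definable_forall_eq {α : Type*} {k : ℕ} (a b : Fin k → α) :
    A.Definable L {z : α → M | ∀ i, z (a i) = z (b i)} := by
  have h := Set.definable_iInter_of_finite
    (fun i : Fin k => definable_eq (L := L) (A := A) (a i) (b i))
  convert h using 1
  ext z
  simp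

theorem definable_prodSet {m n : ℕ} {X : Set (Fin m → M)} {Y : Set (Fin n → M)}
    (hX : A.Definable L X) (hY : A.Definable L Y) : A.Definable L (prodSet X Y) :=
  (hX.preimage_comp (Fin.castAdd n)).inter (hY.preimage_comp (Fin.natAdd m))

/-- A coordinate map that is a bijection `X → Y` is an isomorphism. -/
theorem DefIso.of_coord {m n : ℕ} {X : Set (Fin m → M)} {Y : Set (Fin n → M)}
    (hX : A.Definable L X) (σ : Fin n → Fin m)
    (h : Set.BijOn (fun x : Fin m → M => x ∘ σ) X Y) : DefIso L A X Y := by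
  refine ⟨h.equiv _, ?_⟩
  have h1 := (hX.preimage_comp (Sum.inl : Fin m → Fin m ⊕ Fin n)).inter
    (definable_forall_eq (L := L) (A := A)
      (fun i : Fin n => (Sum.inr i : Fin m ⊕ Fin n)) (fun i => Sum.inl (σ i)))
  convert h1 using 1
  ext z
  constructor
  · rintro ⟨x, hx, hy⟩
    refine ⟨by simp [hx], fun i => ?_⟩
    have h2 := congrFun hy i
    have h3 := congrFun hx (σ i)
    simp only [Function.comp] at h2 h3
    rw [h2, h3]
    rfl
  · rintro ⟨hx, hy⟩
    refine ⟨⟨_, hx⟩, rfl, ?_⟩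
    funext i
    exact hy i

theorem DefIso.refl {m : ℕ} {X : Set (Fin m → M)} (hX : A.Definable L X) : DefIso L A X X :=
  DefIso.of_coord hX id (Set.bijOn_id X)

theorem DefIso.symm {m n : ℕ} {X : Set (Fin m → M)} {Y : Set (Fin n → M)}
    (h : DefIso L A X Y) : DefIso L A Y X := by
  obtain ⟨f, hf⟩ := h
  refine ⟨f.symm, ?_⟩
  convert hf.preimage_comp (Sum.swap : Fin m ⊕ Fin n → Fin n ⊕ Fin m) using 1
  ext z
  constructor
  · rintro ⟨y, hy, hx⟩
    exact ⟨f.symm y, hx, by rw [f.apply_symm_apply]; exact hy⟩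
  · rintro ⟨x, hx, hy⟩
    exact ⟨f x, hy, by rw [f.symm_apply_apply]; exact hx⟩

theorem DefIso.trans {m n k : ℕ} {X : Set (Fin m → M)} {Y : Set (Fin n → M)}
    {Z : Set (Fin k → M)} (h : DefIso L A X Y) (h' : DefIso L A Y Z) : DefIso L A X Z := by
  obtain ⟨f, hf⟩ := h
  obtain ⟨g, hg⟩ := h'
  refine ⟨f.trans g, ?_⟩
  have h1 := (hf.preimage_comp
    (Sum.map Sum.inl id : Fin m ⊕ Fin n → (Fin m ⊕ Fin k) ⊕ Fin n)).inter
    (hg.preimage_comp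
      (Sum.elim Sum.inr (fun i => Sum.inl (Sum.inr i)) :
        Fin n ⊕ Fin k → (Fin m ⊕ Fin k) ⊕ Fin n))
  convert h1.image_comp (Sum.inl : Fin m ⊕ Fin k → (Fin m ⊕ Fin k) ⊕ Fin n) using 1
  ext z
  constructor
  · rintro ⟨x, hx, hz⟩
    exact ⟨Sum.elim z (f x), ⟨⟨x, hx, rfl⟩, ⟨f x, rfl, hz⟩⟩, rfl⟩
  · rintro ⟨t, ⟨⟨x, hx, hy⟩, ⟨y, hy', hz⟩⟩, rfl⟩
    refine ⟨x, hx, ?_⟩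
    have hxy : f x = y := Subtype.ext (hy.symm.trans hy')
    rw [Equiv.trans_apply, hxy]
    exact hz

theorem DefIso.prod {m n m' n' : ℕ} {X : Set (Fin m → M)} {Y : Set (Fin n → M)}
    {X' : Set (Fin m' → M)} {Y' : Set (Fin n' → M)}
    (h : DefIso L A X X') (h' : DefIso L A Y Y') :
    DefIso L A (prodSet X Y) (prodSet X' Y') := by
  obtain ⟨f, hf⟩ := h
  obtain ⟨g, hg⟩ := h'
  have split : ∀ {a b : ℕ} (U : Set (Fin a → M)) (V : Set (Fin b → M)),
      ∃ e : prodSet U V ≃ U × V, ∀ z, ((e z).1 : Fin a → M) = z.1 ∘ Fin.castAdd b ∧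
        ((e z).2 : Fin b → M) = z.1 ∘ Fin.natAdd a := fun {a b} U V =>
    ⟨{ toFun := fun z => (⟨_, z.2.1⟩, ⟨_, z.2.2⟩)
       invFun := fun w => ⟨Fin.append w.1 w.2, by
          constructor
          · convert w.1.2
            funext i
            simp
          · convert w.2.2
            funext i
            simp⟩
       left_inv := fun z => by
          ext i
          refine Fin.addCases (fun i => ?_) (fun i => ?_) i <;> simp
       right_inv := fun w => by
          ext i <;> simp }, fun z => ⟨rfl, rfl⟩⟩
  obtain ⟨e, he⟩ := split X Y
  obtain ⟨e', he'⟩ := split X' Y'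
  refine ⟨e.trans ((f.prodCongr g).trans e'.symm), ?_⟩
  have h1 := (hf.preimage_comp
    (Sum.map (Fin.castAdd n) (Fin.castAdd n') : _ → Fin (m + n) ⊕ Fin (m' + n'))).inter
    (hg.preimage_comp
      (Sum.map (Fin.natAdd m) (Fin.natAdd m') : _ → Fin (m + n) ⊕ Fin (m' + n')))
  convert h1 using 1
  ext z
  constructor
  · rintro ⟨x, hx, hy⟩
    have h2 := he' (e'.symm (f (e x).1, g (e x).2))
    rw [e'.apply_symm_apply] at h2
    refine ⟨⟨(e x).1, ?_, ?_⟩, ⟨(e x).2, ?_, ?_⟩⟩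
    · rw [(he x).1, ← hx]; rfl
    · rw [h2.1]
      exact congrArg (fun t => t ∘ Fin.castAdd n') hy
    · rw [(he x).2, ← hx]; rfl
    · rw [h2.2]
      exact congrArg (fun t => t ∘ Fin.natAdd m') hy
  · rintro ⟨⟨x, hx, hx'⟩, ⟨y, hy, hy'⟩⟩
    have h3 := he (e.symm (x, y))
    rw [e.apply_symm_apply] at h3
    have h2 := he' (e'.symm (f x, g y))
    rw [e'.apply_symm_apply] at h2
    refine ⟨e.symm (x, y), ?_, ?_⟩
    · funext i
      refine Fin.addCases (fun i => ?_) (fun i => ?_) i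
      · exact (congrFun hx i).trans (congrFun h3.1 i)
      · exact (congrFun hy i).trans (congrFun h3.2 i)
    · simp only [Equiv.trans_apply, Equiv.prodCongr_apply, Equiv.apply_symm_apply, Prod.map]
      funext i
      refine Fin.addCases (fun i => ?_) (fun i => ?_) i
      · exact (congrFun hx' i).trans (congrFun h2.1 i)
      · exact (congrFun hy' i).trans (congrFun h2.2 i)

variable (L A)

instance isoSetoid : Setoid (DefSet L A) where
  r X Y := DefIso L A X.carrier Y.carrier
  iseqv :=
    { refl := fun X => DefIso.refl X.definable
      symm := fun h => h.symm
      trans := fun h h' => h.trans h' }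

/-- Isomorphism classes of definable sets. -/
def IsoClass : Type _ := Quotient (isoSetoid L A)

variable {L A}

/-- The isomorphism class of a definable subset of `M^n`, `n > 0`. -/
def isoClass {n : ℕ} (hn : 0 < n) (X : Set (Fin n → M)) (hX : A.Definable L X) : IsoClass L A :=
  Quotient.mk (isoSetoid L A) ⟨n, hn, X, hX⟩

/-- Product of definable sets. -/
abbrev DefSet.prod (X Y : DefSet L A) : DefSet L A :=
  ⟨X.dim + Y.dim, Nat.add_pos_left X.dim_pos _, prodSet X.carrier Y.carrier,
    definable_prodSet X.definable Y.definable⟩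

/-- The one-point set `{c} ⊆ M^1` named by a constant symbol `c`. -/
abbrev DefSet.point (c : L.Constants) : DefSet L A :=
  ⟨1, Nat.one_pos, {z | z 0 = (c : M)}, by
    refine ⟨(FirstOrder.Language.var 0).equal ((L.lhomWithConstants A).onTerm c.term), ?_⟩
    ext
    simp⟩

theorem bijOn_reindex {m n : ℕ} {X : Set (Fin m → M)} {Y : Set (Fin n → M)}
    (σ : Fin n → Fin m) (τ : Fin m → Fin n) (h1 : ∀ i, σ (τ i) = i) (h2 : ∀ i, τ (σ i) = i)
    (h : ∀ x : Fin m → M, x ∘ σ ∈ Y ↔ x ∈ X) :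
    Set.BijOn (fun x : Fin m → M => x ∘ σ) X Y := by
  refine ⟨fun x hx => (h x).2 hx, fun x _ y _ hxy => ?_, fun y hy => ⟨y ∘ τ, ?_, ?_⟩⟩
  · funext i
    have := congrFun hxy (τ i)
    simpa [h1] using this
  · rw [← h]
    convert hy using 1
    funext i
    simp [h2]
  · funext i
    simp [h2]

theorem prodSet_assoc {m n k : ℕ} {X : Set (Fin m → M)} {Y : Set (Fin n → M)}
    {Z : Set (Fin k → M)} (hX : A.Definable L X) (hY : A.Definable L Y) (hZ : A.Definable L Z) :
    DefIso L A (prodSet (prodSet X Y) Z) (prodSet X (prodSet Y Z)) := by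
  refine DefIso.of_coord (definable_prodSet (definable_prodSet hX hY) hZ)
    (Fin.cast (Nat.add_assoc _ _ _).symm)
    (bijOn_reindex _ (Fin.cast (Nat.add_assoc _ _ _)) (fun _ => rfl) (fun _ => rfl) ?_)
  intro x
  refine Iff.trans (and_congr Iff.rfl (and_congr Iff.rfl ?_)) and_assoc.symm
  refine iff_of_eq (congrArg (· ∈ Z) ?_)
  funext i
  refine congrArg x (Fin.ext ?_)
  simp [Nat.add_assoc]

theorem prodSet_comm {m n : ℕ} {X : Set (Fin m → M)} {Y : Set (Fin n → M)}
    (hX : A.Definable L X) (hY : A.Definable L Y) :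
    DefIso L A (prodSet X Y) (prodSet Y X) := by
  refine DefIso.of_coord (definable_prodSet hX hY)
    (finSumFinEquiv ∘ Sum.swap ∘ finSumFinEquiv.symm)
    (bijOn_reindex _ (finSumFinEquiv ∘ Sum.swap ∘ finSumFinEquiv.symm)
      (fun _ => by simp) (fun _ => by simp) ?_)
  intro x
  refine Iff.trans ?_ and_comm
  refine and_congr ?_ ?_
  · refine iff_of_eq (congrArg (· ∈ Y) ?_)
    funext i
    simp
  · refine iff_of_eq (congrArg (· ∈ X) ?_)
    funext i
    simp

theorem point_prodSet {n : ℕ} {X : Set (Fin n → M)} (c : L.Constants) (hX : A.Definable L X) :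
    DefIso L A (prodSet (DefSet.point (A := A) c).carrier X) X := by
  refine DefIso.of_coord (m := 1 + n) (definable_prodSet (DefSet.point c).definable hX)
    (Fin.natAdd 1) ⟨fun x hx => hx.2, ?_, ?_⟩
  · intro x hx y hy hxy
    funext i
    refine Fin.addCases (fun i => ?_) (fun i => ?_) i
    · rw [Subsingleton.elim i (0 : Fin 1)]
      exact Eq.trans (hx.1 : x _ = _) (hy.1 : y _ = _).symm
    · exact congrFun hxy i
  · intro y hy
    refine ⟨Fin.append (fun _ : Fin 1 => (c : M)) y, ⟨?_, ?_⟩, ?_⟩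
    · exact Fin.append_left (fun _ : Fin 1 => (c : M)) y 0
    · convert hy using 1
      funext i
      exact Fin.append_right _ _ i
    · funext i
      exact Fin.append_right _ _ i

/-- Isomorphism classes form a commutative monoid under the cartesian product; the unit is the
class of a point (which is definable as soon as the language has a constant symbol). -/
noncomputable instance [Nonempty L.Constants] : CommMonoid (IsoClass L A) where
  mul := Quotient.map₂ DefSet.prod (fun _ _ h _ _ h' => DefIso.prod h h')
  one := Quotient.mk (isoSetoid L A) (DefSet.point (Classical.arbitrary L.Constants))
  mul_assoc := by
    rintro ⟨X⟩ ⟨Y⟩ ⟨Z⟩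
    exact Quotient.sound (prodSet_assoc X.definable Y.definable Z.definable)
  mul_comm := by
    rintro ⟨X⟩ ⟨Y⟩
    exact Quotient.sound (prodSet_comm X.definable Y.definable)
  one_mul := by
    rintro ⟨X⟩
    exact Quotient.sound (point_prodSet _ X.definable)
  mul_one := by
    rintro ⟨X⟩
    exact Quotient.sound ((prodSet_comm X.definable (DefSet.point _).definable).trans
      (point_prodSet _ X.definable))

/-- The generator `⌊X⌋` of the free abelian group on isomorphism classes. -/
def gen {n : ℕ} (hn : 0 < n) (X : Set (Fin n → M)) (hX : A.Definable L X) :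
    FreeAbelianGroup (IsoClass L A) :=
  FreeAbelianGroup.of (isoClass hn X hX)

variable (L A)

/-- The relations `⌊X⌋ + ⌊Y⌋ - ⌊X ∪ Y⌋ - ⌊X ∩ Y⌋` for definable `X, Y ⊆ M^n`, and `⌊∅⌋`. -/
inductive IsRelation : FreeAbelianGroup (IsoClass L A) → Prop
  | union_inter {n : ℕ} (hn : 0 < n) (X Y : Set (Fin n → M))
      (hX : A.Definable L X) (hY : A.Definable L Y) :
      IsRelation (gen hn X hX + gen hn Y hY
        - gen hn (X ∪ Y) (hX.union hY) - gen hn (X ∩ Y) (hX.inter hY))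
  | empty {n : ℕ} (hn : 0 < n) : IsRelation (gen hn ∅ Set.definable_empty)

/-- The subgroup of the free abelian group generated by the relations. -/
def relationSubgroup : AddSubgroup (FreeAbelianGroup (IsoClass L A)) :=
  AddSubgroup.closure {x | IsRelation L A x}

variable {L A}

theorem gen_mul_gen [Nonempty L.Constants] {m n : ℕ} (hm : 0 < m) (hn : 0 < n)
    {X : Set (Fin m → M)} {Y : Set (Fin n → M)} (hX : A.Definable L X) (hY : A.Definable L Y) :
    gen hm X hX * gen hn Y hY =
      gen (Nat.add_pos_left hm n) (prodSet X Y) (definable_prodSet hX hY) :=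
  FreeAbelianGroup.of_mul_of _ _

theorem mul_mem_relationSubgroup [Nonempty L.Constants] (c : FreeAbelianGroup (IsoClass L A))
    {x : FreeAbelianGroup (IsoClass L A)} (hx : x ∈ relationSubgroup L A) :
    c * x ∈ relationSubgroup L A := by
  induction c using FreeAbelianGroup.induction_on with
  | zero => rw [zero_mul]; exact zero_mem _
  | neg c hc => rw [neg_mul]; exact neg_mem hc
  | add c d hc hd => rw [add_mul]; exact add_mem hc hd
  | of c =>
    obtain ⟨⟨k, hk, Z, hZ⟩⟩ := c
    change gen hk Z hZ * x ∈ _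
    refine AddSubgroup.closure_induction (fun x hx => ?_) ?_ ?_ ?_ hx
    · obtain ⟨hn, X, Y, hX, hY⟩ | ⟨hn⟩ := hx
      · have e1 : prodSet Z (X ∪ Y) = prodSet Z X ∪ prodSet Z Y := by
          ext z
          exact and_or_left
        have e2 : prodSet Z (X ∩ Y) = prodSet Z X ∩ prodSet Z Y := by
          ext z
          exact and_and_left
        simp only [mul_sub, mul_add, gen_mul_gen, e1, e2]
        exact AddSubgroup.subset_closure
          (IsRelation.union_inter _ _ _ (definable_prodSet hZ hX) (definable_prodSet hZ hY))
      · rename_i n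
        have e : prodSet Z (∅ : Set (Fin n → M)) = ∅ := by
          ext z
          simp [prodSet]
        simp only [gen_mul_gen, e]
        exact AddSubgroup.subset_closure (IsRelation.empty _)
    · rw [mul_zero]; exact zero_mem _
    · intro x y _ _ hx hy
      rw [mul_add]; exact add_mem hx hy
    · intro x _ hx
      rw [mul_neg]; exact neg_mem hx

variable (L A)

/-- The subgroup of relations is an ideal for the product induced by cartesian products. -/
def relationIdeal [Nonempty L.Constants] : Ideal (FreeAbelianGroup (IsoClass L A)) :=
  { relationSubgroup L A with smul_mem' := fun c _ hx => mul_mem_relationSubgroup c hx }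

/-- The Grothendieck ring of the structure `M`, for sets definable with parameters from `A`. -/
abbrev GrothendieckRing [Nonempty L.Constants] : Type _ :=
  FreeAbelianGroup (IsoClass L A) ⧸ relationIdeal L A

end General

section Padic

/-- The language of rings with an extra constant symbol. -/
abbrev ringPi : FirstOrder.Language := FirstOrder.Language.ring[[Unit]]

instance : Nonempty ringPi.Constants := ⟨Sum.inl FirstOrder.Ring.zeroFunc⟩

/-- A field `K` as a structure for the language of rings with a constant symbol for `ϖ`. -/
@[reducible] noncomputable def ringPiStructure (K : Type w) [Field K] (ϖ : K) :
    ringPi.Structure K :=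
  letI := FirstOrder.Ring.compatibleRingOfRing K
  letI := FirstOrder.Language.constantsOn.structure (fun _ : Unit => ϖ)
  inferInstance

variable (p : ℕ) [Fact p.Prime] (K : Type w) [Field K] [Algebra ℚ_[p] K]

/-- The valuation ring `R` of an algebraic extension `K` of `ℚ_p`: the elements of absolute value
at most `1`, the absolute value being the extension of the `p`-adic one to `K`. -/
def valRing : Set K := {x | spectralNorm ℚ_[p] K x ≤ 1}

/-- `v(ϖ) = 1` for the valuation `v` of `K` with value group `ℤ`: the element `ϖ` is nonzero, and
its absolute value is the largest one below `1`. -/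
def IsUniformizer (ϖ : K) : Prop :=
  ϖ ≠ 0 ∧ IsGreatest {r : ℝ | ∃ x : K, spectralNorm ℚ_[p] K x = r ∧ r < 1}
    (spectralNorm ℚ_[p] K ϖ)

variable {K} in
/-- A subset of `K`, seen as a subset of `K^1`. -/
def line (S : Set K) : Set (Fin 1 → K) := {z | z 0 ∈ S}

end Padic

end DefinableGrothendieck

/-! Let v be the valuation with v(ϖ) = 1. Units modulo ϖ have a finite exponent, so u ^ N lies in 1
+ ϖR for every unit u and some N > 0. Put d = p * N and l = d + 1. As l is prime to p and to N, u ↦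
u ^ l permutes the units (`unitPowBijective`). Hence R is definable (`definable_valRing`), and x ↦ x
^ l is injective on K \ {0} and multiplies valuations by l.

Let P be the set of x with v(x) in dℕ, and Pl = {x ^ l : x ∈ P}, the set with v(x) in ldℕ.
Multiplication by powers of ϖ makes R \ {0} a disjoint union of d copies of P, one for each residue
of v modulo d. It also makes P \ Pl a disjoint union of l - 1 = d copies of Pl, and Pl ≅ P. So P \
Pl ≅ R \ {0} (`DefIso.shell_univ`), which t ↦ 1 + ϖt carries onto (1 + ϖR) \ {1}.

On the other hand P absorbs 1 + ϖR: the set H = ⋃ ϖ^(dk)(1 + ϖR), k ≥ 0, is the disjoint union of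
ϖ^d H and 1 + ϖR, so P ≅ P \ (1 + ϖR). Combining, P = Pl ⊔ (P \ Pl) ≅ (P \ (1 + ϖR)) ⊔ ((1 + ϖR) \
{1}) = P \ {1} (`DefIso.shell_sdiff_one`). Moving 0 to the freed point 1 gives R ≅ R \ {0}. In the
Grothendieck ring the class of a point, which is the unit, is then zero
(`subsingleton_grothendieckRing`). -/

namespace DefinableGrothendieck

/-! ### Gluing definable bijections; bijections of subsets of the line -/

section DefinableSets

open Set

variable {M : Type w} {L : FirstOrder.Language.{u, v}} [L.Structure M] {A : Set M}

theorem DefIso.union {m n : ℕ} {X Y : Set (Fin m → M)} {X' Y' : Set (Fin n → M)}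
    (hX : DefIso L A X X') (hY : DefIso L A Y Y') (h : Disjoint X Y) (h' : Disjoint X' Y') :
    DefIso L A (X ∪ Y) (X' ∪ Y') := by
  classical
  obtain ⟨f, hf⟩ := hX
  obtain ⟨g, hg⟩ := hY
  refine ⟨(Equiv.Set.union h).trans ((Equiv.sumCongr f g).trans (Equiv.Set.union h').symm), ?_⟩
  convert hf.union hg using 1
  ext z
  simp only [mem_ofPred_eq, mem_union]
  have hl : ∀ (x : Fin m → M) (hx : x ∈ X), Equiv.Set.union h ⟨x, Or.inl hx⟩ = Sum.inl ⟨x, hx⟩ :=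
    fun x hx => Equiv.Set.union_apply_left h (a := ⟨x, Or.inl hx⟩) hx
  have hr : ∀ (x : Fin m → M) (hx : x ∈ Y), Equiv.Set.union h ⟨x, Or.inr hx⟩ = Sum.inr ⟨x, hx⟩ :=
    fun x hx => Equiv.Set.union_apply_right h (a := ⟨x, Or.inr hx⟩) hx
  constructor
  · rintro ⟨⟨x, hx | hx⟩, h1, h2⟩
    · exact Or.inl ⟨⟨x, hx⟩, h1, by simpa [hl x hx] using! h2⟩
    · exact Or.inr ⟨⟨x, hx⟩, h1, by simpa [hr x hx] using! h2⟩
  · rintro (⟨⟨x, hx⟩, h1, h2⟩ | ⟨⟨x, hx⟩, h1, h2⟩)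
    · exact ⟨⟨x, Or.inl hx⟩, h1, by simpa [hl x hx] using! h2⟩
    · exact ⟨⟨x, Or.inr hx⟩, h1, by simpa [hr x hx] using! h2⟩

theorem definable_exists {α : Type*} {P : (α → M) → M → Prop}
    (h : A.Definable L {w : α ⊕ Unit → M | P (fun i => w (Sum.inl i)) (w (Sum.inr ()))}) :
    A.Definable L {v : α → M | ∃ y, P v y} := by
  convert h.exists_of_finite using 1
  ext v
  exact ⟨fun ⟨y, hy⟩ => ⟨fun _ => y, hy⟩, fun ⟨y, hy⟩ => ⟨y (), hy⟩⟩

theorem definable_mem {α : Type*} {S : Set M} {f : (α → M) → M}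
    (hS : A.Definable L (line S)) (hf : A.DefinableFun L f) : A.Definable L {v | f v ∈ S} :=
  hS.preimage_map (F := fun v _ => f v) (fun _ => hf)

theorem definableFun_const_of_nullary {α : Type*} {c : M} (h : A.DefinableFun L fun _ : Fin 0 → M => c) :
    A.DefinableFun L fun _ : α → M => c :=
  Set.DefinableFun.comp (g := fun _ => Fin.elim0) (fun i => i.elim0) h

theorem definable_line_image {S : Set M} {f : M → M} (hS : A.Definable L (line S))
    (hf : ∀ {α : Type} {g : (α → M) → M}, A.DefinableFun L g →
      A.DefinableFun L fun v => f (g v)) : A.Definable L (line (f '' S)) :=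
  definable_exists (α := Fin 1) (P := fun v y => y ∈ S ∧ f y = v 0)
    ((definable_mem hS (Set.DefinableFun.proj L)).inter
      ((hf (Set.DefinableFun.proj L)).ofPred_eq (Set.DefinableFun.proj L)))

/-- Definability of `f` is expressed as stability of definable functions under composition with `f`,
a form that `fun_prop` can discharge for polynomial maps. -/
theorem DefIso.of_injOn {S : Set M} {f : M → M} (hS : A.Definable L (line S))
    (hf : ∀ {α : Type} {g : (α → M) → M}, A.DefinableFun L g →
      A.DefinableFun L fun v => f (g v)) (hi : InjOn f S) :
    DefIso L A (line S) (line (f '' S)) := by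
  have hb : BijOn (fun (x : Fin 1 → M) (_ : Fin 1) => f (x 0)) (line S) (line (f '' S)) := by
    refine ⟨fun x hx => mem_image_of_mem f hx, fun x hx y hy hxy => ?_, ?_⟩
    · funext i
      rw [Subsingleton.elim i 0]
      exact hi hx hy (congrFun hxy 0)
    · rintro y ⟨x, hx, hy⟩
      refine ⟨fun _ => x, hx, ?_⟩
      funext i
      rw [Subsingleton.elim i 0]
      exact hy
  refine ⟨hb.equiv _, ?_⟩
  convert (definable_mem hS (Set.DefinableFun.proj L (i := (Sum.inl 0 : Fin 1 ⊕ Fin 1)))).inter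
    ((hf (Set.DefinableFun.proj L)).ofPred_eq
      (Set.DefinableFun.proj L (i := (Sum.inr 0 : Fin 1 ⊕ Fin 1)))) using 1
  ext z
  constructor
  · rintro ⟨x, hx, hy⟩
    have h0 := congrFun hx 0
    have h1 := congrFun hy 0
    simp only [Function.comp] at h0 h1
    refine ⟨?_, ?_⟩
    · change z _ ∈ S
      rw [h0]
      exact x.2
    · change f (z _) = z _
      rw [h0, h1]
      rfl
  · rintro ⟨hx, hy⟩
    refine ⟨⟨fun i => z (Sum.inl i), hx⟩, rfl, ?_⟩
    funext i
    rw [Subsingleton.elim i 0]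
    exact hy.symm

end DefinableSets

/-! ### Polynomial maps are definable -/

/-- The ring operations of `K` are definable. -/
class DefinableRing {K : Type w} [Field K] (L : FirstOrder.Language.{u, v}) [L.Structure K]
    (A : Set K) : Prop where
  add : A.DefinableFun L fun v : Fin 2 → K => v 0 + v 1
  mul : A.DefinableFun L fun v : Fin 2 → K => v 0 * v 1
  zero : A.DefinableFun L fun _ : Fin 0 → K => (0 : K)
  one : A.DefinableFun L fun _ : Fin 0 → K => (1 : K)

section DefinableRing

open Set

variable {K : Type w} [Field K] {L : FirstOrder.Language.{u, v}} [L.Structure K] {A : Set K}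
  {α : Type*} {f g : (α → K) → K}

variable [DefinableRing L A]

theorem DefinableRing.fun_add (hf : A.DefinableFun L f) (hg : A.DefinableFun L g) :
    A.DefinableFun L fun v => f v + g v :=
  Set.DefinableFun.comp (g := fun v => ![f v, g v])
    (by intro i; fin_cases i <;> assumption) (DefinableRing.add (L := L) (A := A))

theorem DefinableRing.fun_mul (hf : A.DefinableFun L f) (hg : A.DefinableFun L g) :
    A.DefinableFun L fun v => f v * g v :=
  Set.DefinableFun.comp (g := fun v => ![f v, g v])
    (by intro i; fin_cases i <;> assumption) (DefinableRing.mul (L := L) (A := A))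

theorem DefinableRing.fun_zero : A.DefinableFun L fun _ : α → K => (0 : K) :=
  definableFun_const_of_nullary DefinableRing.zero

theorem DefinableRing.fun_one : A.DefinableFun L fun _ : α → K => (1 : K) :=
  definableFun_const_of_nullary DefinableRing.one

theorem DefinableRing.fun_pow (hf : A.DefinableFun L f) (n : ℕ) :
    A.DefinableFun L fun v => f v ^ n := by
  induction n with
  | zero => simpa using fun_one
  | succ n ih => simpa only [pow_succ] using fun_mul ih hf

end DefinableRing

section RingPi

open FirstOrder FirstOrder.Language

variable {K : Type w} [Field K] (ϖ : K) (A : Set K)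

theorem definableRing_ringPi :
    letI : ringPi.Structure K := ringPiStructure K ϖ
    DefinableRing ringPi A := by
  let : ringPi.Structure K := ringPiStructure K ϖ
  exact ⟨(Set.DefinableFun.fun_symbol (L := ringPi) (M := K) (Sum.inl Ring.addFunc)).of_empty,
    (Set.DefinableFun.fun_symbol (L := ringPi) (M := K) (Sum.inl Ring.mulFunc)).of_empty,
    (Set.DefinableFun.fun_symbol (L := ringPi) (M := K) (Sum.inl Ring.zeroFunc)).of_empty,
    (Set.DefinableFun.fun_symbol (L := ringPi) (M := K) (Sum.inl Ring.oneFunc)).of_empty⟩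

theorem definableFun_uniformizer :
    letI : ringPi.Structure K := ringPiStructure K ϖ
    A.DefinableFun ringPi fun _ : Fin 0 → K => ϖ := by
  let : ringPi.Structure K := ringPiStructure K ϖ
  exact (Set.DefinableFun.fun_symbol (L := ringPi) (M := K)
    (Sum.inr () : ringPi.Functions 0)).of_empty

end RingPi

/-! ### A set isomorphic to itself minus a point kills the Grothendieck ring -/

section Point

variable {M : Type w} {L : FirstOrder.Language.{u, v}} [L.Structure M] {A : Set M}

theorem DefIso.of_singleton {m n : ℕ} {x : Fin m → M} {y : Fin n → M}
    (hx : A.Definable L {x}) (hy : A.Definable L {y}) : DefIso L A {x} {y} := by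
  refine ⟨Equiv.ofUnique _ _, ?_⟩
  convert (hx.preimage_comp (Sum.inl : Fin m → Fin m ⊕ Fin n)).inter
    (hy.preimage_comp (Sum.inr : Fin n → Fin m ⊕ Fin n)) using 1
  ext z
  constructor
  · rintro ⟨⟨_, rfl⟩, h1, h2⟩
    exact ⟨h1, h2⟩
  · rintro ⟨h1, h2⟩
    exact ⟨⟨x, rfl⟩, h1, h2⟩

/-- Cutting `X` into `{x}` and `X \ {x}`, whose class is that of `X`, forces the class of `{x}` to
vanish; all definable points are isomorphic, so this class is 1. -/
theorem subsingleton_grothendieckRing [Nonempty L.Constants] {n : ℕ} (hn : 0 < n)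
    {X : Set (Fin n → M)} (x : Fin n → M) (hx : x ∈ X) (hX : A.Definable L X)
    (hd : A.Definable L {x}) (h : DefIso L A X (X \ {x})) :
    Subsingleton (GrothendieckRing L A) := by
  rw [Ideal.Quotient.subsingleton_iff, Ideal.eq_top_iff_one]
  have hr := IsRelation.union_inter hn {x} (X \ {x}) hd (hX.sdiff hd)
  have e1 : gen hn ({x} ∪ X \ {x}) (hd.union (hX.sdiff hd)) = gen hn X hX := by
    congr 1
    exact Set.union_sdiff_cancel (by simpa using hx)
  have e2 : gen hn ({x} ∩ (X \ {x})) (hd.inter (hX.sdiff hd)) =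
      gen hn (∅ : Set (Fin n → M)) (Set.definable_empty (L := L) (A := A)) := by
    congr 1
    simp
  have e3 : gen hn X hX = gen hn (X \ {x}) (hX.sdiff hd) :=
    congrArg FreeAbelianGroup.of (Quotient.sound h)
  have e4 : gen hn {x} hd = (1 : FreeAbelianGroup (IsoClass L A)) := by
    refine congrArg FreeAbelianGroup.of (Quotient.sound ?_)
    have hp := (DefSet.point (A := A) (Classical.arbitrary L.Constants)).definable
    have e : (DefSet.point (A := A) (Classical.arbitrary L.Constants)).carrier =
        {fun _ => ((Classical.arbitrary L.Constants : L.Constants) : M)} := by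
      ext z
      refine ⟨fun hz => ?_, fun hz => congrFun hz 0⟩
      funext i
      rw [Subsingleton.elim i 0]
      exact hz
    change DefIso L A {x} (DefSet.point (A := A) (Classical.arbitrary L.Constants)).carrier
    rw [e] at hp ⊢
    exact DefIso.of_singleton hd hp
  rw [e1, e2, e3, e4] at hr
  have h1 : (1 : FreeAbelianGroup (IsoClass L A)) -
      gen hn (∅ : Set (Fin n → M)) (Set.definable_empty (L := L) (A := A)) ∈
        relationSubgroup L A := by
    have := AddSubgroup.subset_closure hr
    simpa using! this
  have h2 := AddSubgroup.subset_closure (IsRelation.empty (L := L) (A := A) hn)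
  have := add_mem h1 h2
  rwa [sub_add_cancel] at this

end Point

/-! ### Powers of units in an ultrametric field -/

section Ultrametric

open Filter Topology Metric

variable {K : Type w} [NormedField K] [IsUltrametricDist K]

theorem norm_pow_sub_one_le {a : K} (ha : ‖a‖ ≤ 1) (n : ℕ) : ‖a ^ n - 1‖ ≤ ‖a - 1‖ := by
  induction n with
  | zero => simp
  | succ n ih =>
    have e : a ^ (n + 1) - 1 = a ^ n * (a - 1) + (a ^ n - 1) := by ring
    rw [e]
    refine (IsUltrametricDist.norm_add_le_max _ _).trans (max_le ?_ ih)
    rw [norm_mul, norm_pow]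
    exact mul_le_of_le_one_left (norm_nonneg _) (pow_le_one₀ (norm_nonneg _) ha)

theorem norm_eq_one_of_norm_sub_one_lt {a : K} (ha : ‖a - 1‖ < 1) : ‖a‖ = 1 := by
  have := IsUltrametricDist.norm_add_eq_max_of_norm_ne_norm (x := a - 1) (y := 1)
    (by rw [norm_one]; exact ha.ne)
  simpa [ha.le] using this

/-- Factor a ^ p - 1 as a - 1 times the geometric sum; each of the p terms of that sum is within ‖a
- 1‖ of 1, so the sum is within ‖a - 1‖ of p. -/
theorem norm_pow_sub_one_le_mul {a : K} (ha : ‖a‖ ≤ 1) (p : ℕ) :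
    ‖a ^ p - 1‖ ≤ ‖a - 1‖ * max ‖a - 1‖ ‖(p : K)‖ := by
  rw [← mul_geom_sum, norm_mul]
  refine mul_le_mul_of_nonneg_left ?_ (norm_nonneg _)
  have e : ∑ i ∈ Finset.range p, a ^ i = ∑ i ∈ Finset.range p, (a ^ i - 1) + p := by simp
  rw [e]
  refine (IsUltrametricDist.norm_add_le_max _ _).trans (max_le_max ?_ le_rfl)
  exact IsUltrametricDist.norm_sum_le_of_forall_le_of_nonneg (norm_nonneg _)
    fun i _ => norm_pow_sub_one_le ha i

theorem tendsto_pow_prime_pow {p : ℕ} (hp : ‖(p : K)‖ < 1) {a : K} (ha : ‖a - 1‖ < 1) :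
    Tendsto (fun k : ℕ => a ^ p ^ k) atTop (𝓝 1) := by
  have ha1 := (norm_eq_one_of_norm_sub_one_lt ha).le
  set r := max ‖a - 1‖ ‖(p : K)‖
  -- Each p-th power shrinks the distance to 1 by a factor r < 1.
  have hr : ∀ k : ℕ, ‖a ^ p ^ k - 1‖ ≤ r ^ k := by
    intro k
    induction k with
    | zero => simpa using ha.le
    | succ k ih =>
      rw [pow_succ, pow_mul, pow_succ]
      refine (norm_pow_sub_one_le_mul
        ((norm_pow _ _).trans_le (pow_le_one₀ (norm_nonneg _) ha1)) p).trans ?_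
      exact mul_le_mul ih (max_le_max (norm_pow_sub_one_le ha1 _) le_rfl)
        (le_max_of_le_left (norm_nonneg _)) (pow_nonneg (le_max_of_le_left (norm_nonneg _)) _)
  rw [tendsto_iff_norm_sub_tendsto_zero]
  exact squeeze_zero (fun _ => norm_nonneg _) hr
    (tendsto_pow_atTop_nhds_zero_of_lt_one (le_max_of_le_left (norm_nonneg _)) (max_lt ha hp))

/-- Compactness stands in for finiteness of the residue field: finitely many open unit balls cover
the closed one, two powers of u share a ball, and the factorial makes the exponent uniform in u. -/
theorem exists_pow_sub_one_lt (K : Type w) [NormedField K] [IsUltrametricDist K] [ProperSpace K] :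
    ∃ N : ℕ, 0 < N ∧ ∀ u : K, ‖u‖ = 1 → ‖u ^ N - 1‖ < 1 := by
  obtain ⟨t, -, ht, hcov⟩ := (isCompact_closedBall (0 : K) 1).finite_cover_balls one_pos
  have := ht.fintype
  refine ⟨(Fintype.card t).factorial, Nat.factorial_pos _, fun u hu => ?_⟩
  have hc : ∀ i : ℕ, ∃ x : t, dist (u ^ i) x < 1 := fun i => by
    have : u ^ i ∈ closedBall (0 : K) 1 := by simp [hu]
    simpa using! hcov this
  choose g hg using hc
  obtain ⟨i, j, hij, hgij⟩ := Fintype.exists_ne_map_eq_of_card_lt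
    (fun i : Fin (Fintype.card t + 1) => g i) (by simp)
  wlog hlt : i < j generalizing i j
  · exact this j i hij.symm hgij.symm (lt_of_le_of_ne (not_lt.mp hlt) hij.symm)
  have hd : dist (u ^ (j : ℕ)) (u ^ (i : ℕ)) < 1 := by
    refine (dist_triangle_max _ (g i : K) _).trans_lt (max_lt ?_ ?_)
    · rw [show g i = g j from hgij]
      exact hg j
    · rw [dist_comm]
      exact hg i
  obtain ⟨k, hk⟩ := Nat.exists_eq_add_of_lt (show (i : ℕ) < j from hlt)
  have hk1 : ‖u ^ (k + 1) - 1‖ < 1 := by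
    have e : u ^ (j : ℕ) - u ^ (i : ℕ) = u ^ (i : ℕ) * (u ^ (k + 1) - 1) := by
      rw [hk]; ring
    rwa [dist_eq_norm, e, norm_mul, norm_pow, hu, one_pow, one_mul] at hd
  obtain ⟨m, hm⟩ : k + 1 ∣ (Fintype.card t).factorial :=
    Nat.dvd_factorial (Nat.succ_pos _) (by have := j.2; omega)
  rw [hm, pow_mul]
  exact (norm_pow_sub_one_le (by simp [hu]) _).trans_lt hk1

/-- Take m k to be an inverse of l modulo N * p ^ (k + 1): since u ^ (N * p ^ (k + 1)) tends to 1,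
the sequence u ^ m k approximates an l-th root of u. -/
theorem exists_tendsto_pow_mul {p N l : ℕ} (hp : ‖(p : K)‖ < 1) (hp1 : 1 < p) (hN0 : 0 < N)
    (hN : ∀ u : K, ‖u‖ = 1 → ‖u ^ N - 1‖ < 1) (hlp : l.Coprime p) (hlN : l.Coprime N) :
    ∃ m : ℕ → ℕ, ∀ u : K, ‖u‖ = 1 → Tendsto (fun k => u ^ (l * m k)) atTop (𝓝 u) := by
  -- The exponent k + 1 keeps the modulus above 1, so that "remainder 1" makes sense.
  have h : ∀ k : ℕ, ∃ m c : ℕ, l * m = N * p ^ (k + 1) * c + 1 := fun k => by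
    have h1 : 1 < N * p ^ (k + 1) :=
      (Nat.one_lt_pow k.succ_ne_zero hp1).trans_le (Nat.le_mul_of_pos_left _ hN0)
    obtain ⟨m, -, hm⟩ := Nat.exists_mul_mod_eq_one_of_coprime
      (hlN.mul_right (hlp.pow_right (k + 1))) h1
    exact ⟨m, l * m / (N * p ^ (k + 1)), by
      conv_lhs => rw [← Nat.div_add_mod (l * m) (N * p ^ (k + 1)), hm]⟩
  choose m c hm using h
  refine ⟨m, fun u hu => ?_⟩
  have h1 := (tendsto_iff_norm_sub_tendsto_zero.mp (tendsto_pow_prime_pow hp (hN u hu))).comp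
    (tendsto_add_atTop_nat 1)
  rw [tendsto_iff_norm_sub_tendsto_zero]
  refine squeeze_zero (fun _ => norm_nonneg _) (fun k => ?_) h1
  have e : u ^ (l * m k) - u = u * (((u ^ N) ^ p ^ (k + 1)) ^ c k - 1) := by
    rw [hm]; ring
  rw [e, norm_mul, hu, one_mul]
  exact norm_pow_sub_one_le (by simp [hu]) _

/-- `l` is an exponent for which `u ↦ u ^ l` permutes the elements of norm one. -/
structure UnitPowBijective (K : Type w) [NormedField K] (l : ℕ) : Prop where
  eq_one : ∀ u : K, u ^ l = 1 → u = 1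
  exists_pow : ∀ w : K, ‖w‖ = 1 → ∃ u : K, u ^ l = w

theorem unitPowBijective [ProperSpace K] {p N l : ℕ} (hp : ‖(p : K)‖ < 1) (hp1 : 1 < p)
    (hN0 : 0 < N) (hN : ∀ u : K, ‖u‖ = 1 → ‖u ^ N - 1‖ < 1) (hlp : l.Coprime p)
    (hlN : l.Coprime N) (hl : l ≠ 0) : UnitPowBijective K l := by
  obtain ⟨m, hm⟩ := exists_tendsto_pow_mul hp hp1 hN0 hN hlp hlN
  refine ⟨fun u hu => ?_, fun w hw => ?_⟩
  · have hn : ‖u‖ = 1 := by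
      rw [← pow_eq_one_iff_of_nonneg (norm_nonneg u) hl, ← norm_pow, hu, norm_one]
    have := hm u hn
    simp only [pow_mul, hu, one_pow] at this
    exact tendsto_nhds_unique this tendsto_const_nhds
  -- The l-th powers of units form a compact set, hence a closed one, and w is a limit of them.
  · have hc : IsClosed ((fun u : K => u ^ l) '' sphere 0 1) :=
      ((isCompact_sphere (0 : K) 1).image (continuous_pow l)).isClosed
    obtain ⟨u, -, hu⟩ := hc.mem_of_tendsto (hm w hw) (Eventually.of_forall fun k =>
      ⟨w ^ m k, by simp [hw], by simp only [← pow_mul, mul_comm]⟩)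
    exact ⟨u, hu⟩

end Ultrametric

/-! ### Sets cut out by the valuation -/

section Shell

variable {K : Type w} [NormedField K]

theorem UnitPowBijective.injOn {l : ℕ} (hb : UnitPowBijective K l) :
    Set.InjOn (fun x : K => x ^ l) {0}ᶜ := by
  intro x hx y hy hxy
  have := hb.eq_one (x / y) (by
    rw [div_pow]; simp only at hxy; rw [hxy, div_self (pow_ne_zero l hy)])
  exact (div_eq_one_iff_eq hy).mp this

/-- `ϖ` generates the maximal ideal of the valuation ring. -/
structure NormUniformizer (ϖ : K) : Prop where
  ne_zero : ϖ ≠ 0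
  norm_lt_one : ‖ϖ‖ < 1
  norm_le : ∀ x : K, ‖x‖ < 1 → ‖x‖ ≤ ‖ϖ‖

namespace NormUniformizer

variable {ϖ : K} (h : NormUniformizer ϖ)

include h

theorem norm_pos : 0 < ‖ϖ‖ := norm_pos_iff.mpr h.ne_zero

/-- If ‖x‖ lay strictly between two consecutive powers of ‖ϖ‖, dividing by a power of ϖ would give a
norm strictly between ‖ϖ‖ and 1. -/
theorem exists_norm_eq {x : K} (hx0 : x ≠ 0) (hx : ‖x‖ ≤ 1) : ∃ n : ℕ, ‖x‖ = ‖ϖ‖ ^ n := by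
  obtain ⟨n, h1, h2⟩ := exists_nat_pow_near_of_lt_one (norm_pos_iff.mpr hx0) hx h.norm_pos
    h.norm_lt_one
  refine ⟨n, h2.antisymm (not_lt.mp fun h3 => ?_)⟩
  have hn := pow_pos h.norm_pos n
  have h4 : ‖x / ϖ ^ n‖ < 1 := by rwa [norm_div, norm_pow, div_lt_one hn]
  have h5 := h.norm_le _ h4
  rw [norm_div, norm_pow, div_le_iff₀ hn, ← pow_succ'] at h5
  exact absurd h1 (not_lt.mpr h5)

theorem pow_inj {m n : ℕ} (e : ‖ϖ‖ ^ m = ‖ϖ‖ ^ n) : m = n :=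
  pow_right_injective₀ h.norm_pos h.norm_lt_one.ne e

/-- This formula defines R. For x in R the right side is a unit, hence an l-th power; otherwise its
valuation is 1 + l v(x), which l does not divide. -/
theorem norm_le_one_iff [IsUltrametricDist K] {l : ℕ} (hl : 2 ≤ l) (hb : UnitPowBijective K l) (x : K) :
    ‖x‖ ≤ 1 ↔ ∃ y, y ^ l = 1 + ϖ * x ^ l := by
  constructor
  · intro hx
    refine hb.exists_pow _ (norm_eq_one_of_norm_sub_one_lt ?_)
    rw [add_sub_cancel_left, norm_mul, norm_pow]
    exact (mul_le_of_le_one_right (norm_nonneg _)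
      (pow_le_one₀ (norm_nonneg _) hx)).trans_lt h.norm_lt_one
  · rintro ⟨y, hy⟩
    by_contra! hx
    have hx0 : x ≠ 0 := by
      rintro rfl
      simp at hx
      linarith
    obtain ⟨n, hn⟩ := h.exists_norm_eq (inv_ne_zero hx0) (by
      rw [norm_inv]; exact inv_le_one_of_one_le₀ hx.le)
    have hn0 : n ≠ 0 := by
      rintro rfl
      rw [norm_inv, pow_zero, inv_eq_one] at hn
      exact hx.ne' hn
    have hc := h.norm_pos
    have hxn : ‖x‖ * ‖ϖ‖ ^ n = 1 := by
      rw [← hn, norm_inv, mul_inv_cancel₀ (norm_ne_zero_iff.mpr hx0)]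
    have hgt : 1 < ‖ϖ * x ^ l‖ := by
      rw [norm_mul, norm_pow]
      -- One factor x absorbs ϖ by discreteness; as l ≥ 2, another factor of norm above 1 remains.
      have h1 : 1 ≤ ‖ϖ‖ * ‖x‖ := by
        rw [← hxn, mul_comm]
        exact mul_le_mul_of_nonneg_right
          (by simpa using pow_le_pow_of_le_one hc.le h.norm_lt_one.le (Nat.one_le_iff_ne_zero.mpr hn0))
          (norm_nonneg _)
      obtain ⟨k, rfl⟩ := Nat.exists_eq_add_of_le hl
      calc (1 : ℝ) < ‖x‖ := hx
        _ ≤ ‖ϖ‖ * ‖x‖ * ‖x‖ := le_mul_of_one_le_left (norm_nonneg _) h1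
        _ ≤ ‖ϖ‖ * ‖x‖ * ‖x‖ * ‖x‖ ^ k :=
          le_mul_of_one_le_right (by positivity) (one_le_pow₀ hx.le)
        _ = ‖ϖ‖ * ‖x‖ ^ (2 + k) := by ring
    have hyn : ‖y‖ ^ l = ‖ϖ‖ * ‖x‖ ^ l := by
      rw [← norm_pow, hy, IsUltrametricDist.norm_add_eq_max_of_norm_ne_norm
        (by rw [norm_one]; exact hgt.ne), norm_one, max_eq_right hgt.le, norm_mul, norm_pow]
    have hy1 : 1 < ‖y‖ := by
      rw [← one_lt_pow_iff_of_nonneg (norm_nonneg _) (by omega : l ≠ 0), hyn, ← norm_pow,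
        ← norm_mul]
      exact hgt
    have hy0 : y ≠ 0 := by
      rintro rfl
      simp at hy1
      linarith
    obtain ⟨m, hm⟩ := h.exists_norm_eq (inv_ne_zero hy0) (by
      rw [norm_inv]; exact inv_le_one_of_one_le₀ hy1.le)
    have hym : ‖y‖ * ‖ϖ‖ ^ m = 1 := by
      rw [← hm, norm_inv, mul_inv_cancel₀ (norm_ne_zero_iff.mpr hy0)]
    -- Here v(x) = -n and v(y) = -m; comparing valuations gives n * l = m * l + 1.
    have e : ‖ϖ‖ ^ (n * l) = ‖ϖ‖ ^ (m * l + 1) := by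
      calc ‖ϖ‖ ^ (n * l) = (‖y‖ * ‖ϖ‖ ^ m) ^ l * ‖ϖ‖ ^ (n * l) := by rw [hym]; simp
        _ = ‖y‖ ^ l * ‖ϖ‖ ^ (m * l) * ‖ϖ‖ ^ (n * l) := by ring
        _ = (‖x‖ * ‖ϖ‖ ^ n) ^ l * ‖ϖ‖ ^ (m * l + 1) := by rw [hyn]; ring
        _ = ‖ϖ‖ ^ (m * l + 1) := by rw [hxn]; simp
    have e' := h.pow_inj e
    have hd : l ∣ 1 := by
      rw [← Nat.dvd_add_right (Dvd.intro_left m rfl), ← e']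
      exact Dvd.intro_left n rfl
    have := Nat.le_of_dvd one_pos hd
    omega

end NormUniformizer

/-- The elements whose valuation, normalized by `v ϖ = 1`, lies in `J`. -/
def shell (ϖ : K) (J : Set ℕ) : Set K := {x | ∃ n ∈ J, ‖x‖ = ‖ϖ‖ ^ n}

theorem shell_union (ϖ : K) (I J : Set ℕ) : shell ϖ (I ∪ J) = shell ϖ I ∪ shell ϖ J := by
  ext x
  simp only [shell, Set.mem_union, Set.mem_ofPred_eq, or_and_right, exists_or]

theorem shell_image_mul {ϖ : K} (hϖ : ϖ ≠ 0) (i : ℕ) (J : Set ℕ) :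
    (fun x => ϖ ^ i * x) '' shell ϖ J = shell ϖ ((fun n => i + n) '' J) := by
  ext x
  constructor
  · rintro ⟨x, ⟨n, hn, hx⟩, rfl⟩
    exact ⟨i + n, ⟨n, hn, rfl⟩, by rw [norm_mul, norm_pow, hx, pow_add]⟩
  · rintro ⟨_, ⟨n, hn, rfl⟩, hx⟩
    have hi := pow_ne_zero i hϖ
    refine ⟨x / ϖ ^ i, ⟨n, hn, ?_⟩, mul_div_cancel₀ _ hi⟩
    rw [norm_div, norm_pow, hx, pow_add, mul_div_cancel_left₀]
    exact pow_ne_zero i (norm_ne_zero_iff.mpr hϖ)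

namespace NormUniformizer

variable {ϖ : K} (h : NormUniformizer ϖ)

include h

theorem shell_disjoint {I J : Set ℕ} (hIJ : Disjoint I J) :
    Disjoint (shell ϖ I) (shell ϖ J) := by
  rw [Set.disjoint_left] at hIJ ⊢
  rintro x ⟨m, hm, hx⟩ ⟨n, hn, hx'⟩
  exact hIJ hm (h.pow_inj (hx.symm.trans hx') ▸ hn)

theorem shell_sdiff (I J : Set ℕ) : shell ϖ (I \ J) = shell ϖ I \ shell ϖ J := by
  ext x
  constructor
  · rintro ⟨n, hn, hx⟩
    refine ⟨⟨n, hn.1, hx⟩, ?_⟩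
    rintro ⟨m, hm, hx'⟩
    exact hn.2 (h.pow_inj (hx.symm.trans hx') ▸ hm)
  · rintro ⟨⟨n, hn, hx⟩, hx'⟩
    exact ⟨n, ⟨hn, fun hJ => hx' ⟨n, hJ, hx⟩⟩, hx⟩

theorem shell_univ : shell ϖ Set.univ = {x | ‖x‖ ≤ 1} \ {0} := by
  ext x
  constructor
  · rintro ⟨n, -, hx⟩
    refine ⟨?_, ?_⟩
    · change ‖x‖ ≤ 1
      rw [hx]
      exact pow_le_one₀ h.norm_pos.le h.norm_lt_one.le
    · rintro rfl
      rw [norm_zero] at hx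
      exact (pow_pos h.norm_pos n).ne hx
  · rintro ⟨hx, hx0⟩
    obtain ⟨n, hn⟩ := h.exists_norm_eq hx0 hx
    exact ⟨n, trivial, hn⟩

/-- An element of valuation l * n is ϖ ^ (n * l) times a unit, and the unit has an l-th root. -/
theorem shell_image_pow {l : ℕ} (hb : UnitPowBijective K l) (hl : l ≠ 0) (J : Set ℕ) :
    (fun x => x ^ l) '' shell ϖ J = shell ϖ ((fun n => l * n) '' J) := by
  ext x
  constructor
  · rintro ⟨x, ⟨n, hn, hx⟩, rfl⟩
    exact ⟨l * n, ⟨n, hn, rfl⟩, by rw [norm_pow, hx, mul_comm, pow_mul]⟩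
  · rintro ⟨_, ⟨n, hn, rfl⟩, hx⟩
    have hi := pow_ne_zero (n * l) h.ne_zero
    obtain ⟨u, hu⟩ := hb.exists_pow (x / ϖ ^ (n * l)) (by
      rw [norm_div, norm_pow, hx, mul_comm, div_self]
      exact pow_ne_zero _ h.norm_pos.ne')
    have hx1 : (ϖ ^ n * u) ^ l = x := by
      rw [mul_pow, hu, ← pow_mul, mul_div_cancel₀ _ hi]
    refine ⟨ϖ ^ n * u, ⟨n, hn, ?_⟩, hx1⟩
    refine (pow_left_inj₀ (norm_nonneg _) (pow_nonneg (norm_nonneg _) _) hl).mp ?_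
    rw [← norm_pow, hx1, hx, ← pow_mul, mul_comm n l]

end NormUniformizer

/-- The union of the cosets of the principal units by the powers of `ϖ ^ d`, inside the valuation
ring, when `d` is a multiple of the exponent of the group of units modulo `ϖ`. -/
def powShell (ϖ : K) (d : ℕ) : Set K :=
  {x | ‖x‖ ≤ 1 ∧ ∃ z t : K, z ≠ 0 ∧ ‖t‖ ≤ 1 ∧ x = z ^ d * (1 + ϖ * t)}

namespace NormUniformizer

variable {ϖ : K} (h : NormUniformizer ϖ)

include h

theorem image_valRing : (fun t => 1 + ϖ * t) '' {x | ‖x‖ ≤ 1} = {x | ‖x - 1‖ < 1} := by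
  ext x
  constructor
  · rintro ⟨t, ht, rfl⟩
    change ‖1 + ϖ * t - 1‖ < 1
    rw [add_sub_cancel_left, norm_mul]
    exact (mul_le_of_le_one_right (norm_nonneg _) ht).trans_lt h.norm_lt_one
  · intro hx
    refine ⟨(x - 1) / ϖ, ?_, ?_⟩
    · change ‖(x - 1) / ϖ‖ ≤ 1
      rw [norm_div]
      exact div_le_one_of_le₀ (h.norm_le _ hx) (norm_nonneg _)
    · change 1 + ϖ * ((x - 1) / ϖ) = x
      rw [mul_div_cancel₀ _ h.ne_zero, add_sub_cancel]

variable [IsUltrametricDist K] {d : ℕ}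

theorem norm_one_add {t : K} (ht : ‖t‖ ≤ 1) : ‖1 + ϖ * t‖ = 1 :=
  norm_eq_one_of_norm_sub_one_lt (h.image_valRing.subset ⟨t, ht, rfl⟩)

theorem powShell_subset (hd : d ≠ 0) : powShell ϖ d ⊆ shell ϖ (Set.range fun n => d * n) := by
  rintro x ⟨hx, z, t, hz, ht, rfl⟩
  rw [norm_mul, h.norm_one_add ht, mul_one, norm_pow, pow_le_one_iff_of_nonneg (norm_nonneg _) hd]
    at hx
  obtain ⟨n, hn⟩ := h.exists_norm_eq hz hx
  refine ⟨d * n, ⟨n, rfl⟩, ?_⟩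
  rw [norm_mul, h.norm_one_add ht, mul_one, norm_pow, hn, ← pow_mul, mul_comm]

/-- In z ^ d * (1 + ϖt), either ϖ divides z and ϖ ^ d can be split off, or z is a unit and z ^ d
already lies in 1 + ϖR by `hN`. -/
theorem powShell_eq_union (hd : d ≠ 0) (hN : ∀ u : K, ‖u‖ = 1 → ‖u ^ d - 1‖ < 1) :
    powShell ϖ d = (fun x => ϖ ^ d * x) '' powShell ϖ d ∪ {x | ‖x - 1‖ < 1} := by
  ext x
  constructor
  · rintro ⟨hx, z, t, hz, ht, rfl⟩
    rw [norm_mul, h.norm_one_add ht, mul_one, norm_pow,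
      pow_le_one_iff_of_nonneg (norm_nonneg _) hd] at hx
    rcases hx.lt_or_eq with hx | hx
    · have hz1 : ‖z / ϖ‖ ≤ 1 := by
        rw [norm_div]
        exact div_le_one_of_le₀ (h.norm_le _ hx) (norm_nonneg _)
      refine Or.inl ⟨(z / ϖ) ^ d * (1 + ϖ * t), ⟨?_, z / ϖ, t, div_ne_zero hz h.ne_zero, ht, rfl⟩,
        ?_⟩
      · rw [norm_mul, h.norm_one_add ht, mul_one, norm_pow]
        exact pow_le_one₀ (norm_nonneg _) hz1
      · change ϖ ^ d * ((z / ϖ) ^ d * (1 + ϖ * t)) = _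
        rw [← mul_assoc, ← mul_pow, mul_div_cancel₀ _ h.ne_zero]
    · right
      have e : z ^ d * (1 + ϖ * t) - 1 = z ^ d * (1 + ϖ * t - 1) + (z ^ d - 1) := by ring
      change ‖z ^ d * (1 + ϖ * t) - 1‖ < 1
      rw [e]
      refine (IsUltrametricDist.norm_add_le_max _ _).trans_lt (max_lt ?_ (hN z hx))
      rw [norm_mul, norm_pow, hx, one_pow, one_mul]
      exact h.image_valRing.subset ⟨t, ht, rfl⟩
  · rintro (⟨_, ⟨hx, z, t, hz, ht, rfl⟩, rfl⟩ | hx)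
    · refine ⟨?_, ϖ * z, t, mul_ne_zero h.ne_zero hz, ht, ?_⟩
      · rw [norm_mul, norm_pow]
        exact mul_le_one₀ (pow_le_one₀ (norm_nonneg _) h.norm_lt_one.le) (norm_nonneg _) hx
      · change ϖ ^ d * (z ^ d * (1 + ϖ * t)) = _
        ring
    · have hx1 := norm_eq_one_of_norm_sub_one_lt hx
      rw [← h.image_valRing] at hx
      obtain ⟨t, ht, rfl⟩ := hx
      exact ⟨hx1.le, 1, t, one_ne_zero, ht, by simp⟩

theorem powShell_disjoint (hd : d ≠ 0) :
    Disjoint ((fun x => ϖ ^ d * x) '' powShell ϖ d) {x | ‖x - 1‖ < 1} := by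
  rw [Set.disjoint_left]
  rintro _ ⟨x, hx, rfl⟩ hx1
  have := norm_eq_one_of_norm_sub_one_lt hx1
  rw [norm_mul, norm_pow] at this
  have h2 := mul_le_of_le_one_right (pow_nonneg h.norm_pos.le d) hx.1
  rw [this] at h2
  exact absurd (pow_lt_one₀ h.norm_pos.le h.norm_lt_one hd) (not_lt.mpr h2)

end NormUniformizer

end Shell

/-! ### Definable bijections between these sets -/

section ShellDefinable

open Set

attribute [fun_prop] DefinableRing.fun_add DefinableRing.fun_mul DefinableRing.fun_pow
  DefinableRing.fun_zero DefinableRing.fun_one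

variable {K : Type w} [NormedField K] {L : FirstOrder.Language.{u, v}} [L.Structure K]
  {A : Set K} [DefinableRing L A] {ϖ : K} (hϖ : A.DefinableFun L fun _ : Fin 0 → K => ϖ)
  (h : NormUniformizer ϖ) {d l : ℕ}

include hϖ h

theorem definable_valRing [IsUltrametricDist K] (hl : 2 ≤ l) (hb : UnitPowBijective K l) :
    A.Definable L (line {x : K | ‖x‖ ≤ 1}) := by
  have e : line {x : K | ‖x‖ ≤ 1} = {v | ∃ y, y ^ l = 1 + ϖ * (v 0) ^ l} := by
    ext v
    exact h.norm_le_one_iff hl hb (v 0)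
  rw [e]
  have := fun α : Type => definableFun_const_of_nullary (α := α) hϖ
  exact definable_exists (Set.DefinableFun.ofPred_eq (by fun_prop) (by fun_prop))

omit hϖ in
theorem definable_shell (hR : A.Definable L (line {x : K | ‖x‖ ≤ 1})) (hd : d ≠ 0) :
    A.Definable L (line (shell ϖ (range fun n => d * n))) := by
  -- Valuation divisible by d means a d-th power times a unit u; the inverse t in R expresses that u
  -- is a unit.
  have e : line (shell ϖ (range fun n => d * n)) =
      {v | v 0 ∈ {x : K | ‖x‖ ≤ 1} ∧ ∃ z u t : K, z ≠ 0 ∧ u ∈ {x : K | ‖x‖ ≤ 1} ∧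
        t ∈ {x : K | ‖x‖ ≤ 1} ∧ u * t = 1 ∧ v 0 = z ^ d * u} := by
    ext v
    constructor
    · rintro ⟨_, ⟨n, rfl⟩, hx⟩
      simp only at hx
      have hu : ‖v 0 / (ϖ ^ n) ^ d‖ = 1 := by
        rw [norm_div, hx, norm_pow, norm_pow, ← pow_mul, mul_comm n d, div_self]
        exact pow_ne_zero _ h.norm_pos.ne'
      have hu0 : v 0 / (ϖ ^ n) ^ d ≠ 0 := by
        rw [← norm_ne_zero_iff, hu]
        exact one_ne_zero
      refine ⟨?_, ϖ ^ n, v 0 / (ϖ ^ n) ^ d, (v 0 / (ϖ ^ n) ^ d)⁻¹, pow_ne_zero n h.ne_zero,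
        hu.le, ?_, mul_inv_cancel₀ hu0,
        (mul_div_cancel₀ _ (pow_ne_zero _ (pow_ne_zero _ h.ne_zero))).symm⟩
      · change ‖v 0‖ ≤ 1
        rw [hx]
        exact pow_le_one₀ h.norm_pos.le h.norm_lt_one.le
      · change ‖(v 0 / (ϖ ^ n) ^ d)⁻¹‖ ≤ 1
        rw [norm_inv, hu, inv_one]
    · rintro ⟨hx, z, u, t, hz, hu, ht, hut, e⟩
      have hu1 : ‖u‖ = 1 := by
        refine le_antisymm hu ?_
        calc (1 : ℝ) = ‖u‖ * ‖t‖ := by rw [← norm_mul, hut, norm_one]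
          _ ≤ ‖u‖ := mul_le_of_le_one_right (norm_nonneg _) ht
      have hn : ‖v 0‖ = ‖z‖ ^ d := by rw [e, norm_mul, hu1, mul_one, norm_pow]
      have hz1 : ‖z‖ ≤ 1 := by
        rw [← pow_le_one_iff_of_nonneg (norm_nonneg _) hd, ← hn]
        exact hx
      obtain ⟨n, hzn⟩ := h.exists_norm_eq hz hz1
      exact ⟨d * n, ⟨n, rfl⟩, by rw [hn, hzn, ← pow_mul, mul_comm]⟩
  rw [e]
  refine (definable_mem hR (by fun_prop)).inter
    (definable_exists (definable_exists (definable_exists ?_)))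
  refine (Set.Definable.compl (Set.DefinableFun.ofPred_eq ?_ ?_)).inter
    ((definable_mem hR ?_).inter ((definable_mem hR ?_).inter
    ((Set.DefinableFun.ofPred_eq ?_ ?_).inter (Set.DefinableFun.ofPred_eq ?_ ?_)))) <;> fun_prop

omit h in
theorem definable_powShell (hR : A.Definable L (line {x : K | ‖x‖ ≤ 1})) :
    A.Definable L (line (powShell ϖ d)) := by
  have := fun α : Type => definableFun_const_of_nullary (α := α) hϖ
  refine (definable_mem hR (by fun_prop)).inter (definable_exists (definable_exists ?_))
  refine (Set.Definable.compl (Set.DefinableFun.ofPred_eq ?_ ?_)).inter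
    ((definable_mem hR ?_).inter (Set.DefinableFun.ofPred_eq ?_ ?_)) <;> fun_prop

omit [DefinableRing L A] hϖ in
theorem DefIso.line_shell_union {I J I' J' : Set ℕ}
    (h1 : DefIso L A (line (shell ϖ I)) (line (shell ϖ I')))
    (h2 : DefIso L A (line (shell ϖ J)) (line (shell ϖ J')))
    (hIJ : Disjoint I J) (hIJ' : Disjoint I' J') :
    DefIso L A (line (shell ϖ (I ∪ J))) (line (shell ϖ (I' ∪ J'))) := by
  rw [shell_union, shell_union]
  exact DefIso.union h1 h2 ((h.shell_disjoint hIJ).preimage (fun v : Fin 1 → K => v 0))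
    ((h.shell_disjoint hIJ').preimage (fun v : Fin 1 → K => v 0))

theorem DefIso.shell_add {J : Set ℕ} (hJ : A.Definable L (line (shell ϖ J))) (i : ℕ) :
    DefIso L A (line (shell ϖ J)) (line (shell ϖ ((fun n => i + n) '' J))) := by
  rw [← shell_image_mul h.ne_zero]
  refine DefIso.of_injOn hJ (fun {α g} hg => ?_)
    (mul_right_injective₀ (pow_ne_zero i h.ne_zero)).injOn
  have := definableFun_const_of_nullary (α := α) hϖ
  fun_prop

omit hϖ in
theorem definable_shell_mul (hb : UnitPowBijective K l) (hl : l ≠ 0) {J : Set ℕ}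
    (hJ : A.Definable L (line (shell ϖ J))) :
    A.Definable L (line (shell ϖ ((fun n => l * n) '' J))) := by
  rw [← h.shell_image_pow hb hl]
  exact definable_line_image hJ fun hg => by fun_prop

omit hϖ in
theorem DefIso.shell_mul (hb : UnitPowBijective K l) (hl : l ≠ 0) {J : Set ℕ}
    (hJ : A.Definable L (line (shell ϖ J))) :
    DefIso L A (line (shell ϖ J)) (line (shell ϖ ((fun n => l * n) '' J))) := by
  rw [← h.shell_image_pow hb hl]
  refine DefIso.of_injOn hJ (fun hg => by fun_prop) (hb.injOn.mono ?_)
  rintro x ⟨n, -, hx⟩ (rfl : x = 0)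
  rw [norm_zero] at hx
  exact (pow_pos h.norm_pos n).ne hx

/-- The i-th class i + dℕ is moved to d(i + 1) + dlℕ: divide by ϖ ^ i, raise to the power l,
multiply by ϖ ^ (d(i + 1)). Induction on n glues the pieces. -/
theorem DefIso.shell_residues (hb : UnitPowBijective K l) (hdl : d < l)
    (hA : A.Definable L (line (shell ϖ (range fun n => d * n)))) (n : ℕ) (hn : n ≤ d) :
    DefIso L A (line (shell ϖ {m | ∃ i < n, ∃ k, m = i + d * k}))
      (line (shell ϖ {m | ∃ i < n, ∃ k, m = d * (i + 1 + l * k)})) := by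
  -- Uniqueness of remainders, used modulo d on the source and modulo l on the target, keeps the
  -- pieces disjoint.
  have cancel : ∀ {m a b k k' : ℕ}, a < m → b < m → a + m * k = b + m * k' → a = b := by
    intro m a b k k' ha hb e
    simpa [Nat.mod_eq_of_lt ha, Nat.mod_eq_of_lt hb] using congrArg (· % m) e
  induction n with
  | zero =>
    have e : ∀ f : ℕ → ℕ → ℕ, line (shell ϖ {m | ∃ i < 0, ∃ k, m = f i k}) = ∅ := by
      intro f
      ext v
      simp [line, shell]
    rw [e fun i k => i + d * k, e fun i k => d * (i + 1 + l * k)]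
    exact DefIso.refl definable_empty
  | succ n ih =>
    have e : ∀ f : ℕ → ℕ → ℕ, {m | ∃ i < n + 1, ∃ k, m = f i k} =
        {m | ∃ i < n, ∃ k, m = f i k} ∪ range (f n) := by
      intro f
      ext m
      simp only [Nat.lt_succ_iff_lt_or_eq, mem_union, mem_range, mem_ofPred_eq, or_and_right,
        exists_or, exists_eq_left, eq_comm (a := m)]
    rw [e fun i k => i + d * k, e fun i k => d * (i + 1 + l * k)]
    refine DefIso.line_shell_union h (ih (by omega)) ?_ ?_ ?_
    · have h1 := DefIso.shell_add hϖ h hA n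
      have h2 := DefIso.shell_mul h hb (by omega) hA
      have h3 := DefIso.shell_add hϖ h (definable_shell_mul h hb (by omega) hA) (d * (n + 1))
      have := h1.symm.trans (h2.trans h3)
      simp only [← range_comp] at this
      have e' : (fun k => d * (n + 1 + l * k)) =
          (fun m => d * (n + 1) + m) ∘ (fun m => l * m) ∘ fun m => d * m := by
        funext k
        change d * (n + 1 + l * k) = d * (n + 1) + l * (d * k)
        ring
      rw [e']
      exact this
    · rw [Set.disjoint_left]
      rintro _ ⟨i, hi, k, rfl⟩ ⟨k', e'⟩
      have := cancel (by omega) (by omega) e'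
      omega
    · rw [Set.disjoint_left]
      rintro _ ⟨i, hi, k, rfl⟩ ⟨k', e'⟩
      have := cancel (by omega) (by omega) (Nat.eq_of_mul_eq_mul_left (by omega) e')
      omega

/-- The choice l = d + 1 matches the d residues modulo d with the d nonzero residues modulo l. -/
theorem DefIso.shell_univ (hb : UnitPowBijective K l) (hd : 0 < d) (hdl : l = d + 1)
    (hA : A.Definable L (line (shell ϖ (range fun n => d * n)))) :
    DefIso L A (line (shell ϖ univ))
      (line (shell ϖ (range (fun n => d * n) \ (fun n => l * n) '' range (fun n => d * n)))) := by
  have := DefIso.shell_residues hϖ h hb (by omega) hA d le_rfl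
  convert this using 3
  · refine (eq_univ_of_forall fun m => ?_).symm
    exact ⟨m % d, Nat.mod_lt _ hd, m / d, (Nat.mod_add_div m d).symm⟩
  · ext m
    constructor
    · rintro ⟨⟨n, rfl⟩, hm⟩
      have hn := Nat.mod_add_div n l
      have hlt := Nat.mod_lt n (show l > 0 by omega)
      rcases Nat.eq_zero_or_pos (n % l) with h0 | h0
      · refine (hm ⟨d * (n / l), ⟨n / l, rfl⟩, ?_⟩).elim
        change l * (d * (n / l)) = d * n
        rw [h0, zero_add] at hn
        rw [mul_left_comm, hn]
      · exact ⟨n % l - 1, by omega, n / l, by rw [Nat.sub_add_cancel h0, hn]⟩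
    · rintro ⟨i, hi, k, rfl⟩
      refine ⟨⟨_, rfl⟩, ?_⟩
      rintro ⟨_, ⟨k', rfl⟩, e⟩
      have e' : l * k' = i + 1 + l * k :=
        Nat.eq_of_mul_eq_mul_left hd (by simpa [mul_left_comm] using e)
      have := congrArg (· % l) e'
      simp only [Nat.mul_mod_right, Nat.add_mul_mod_self_left] at this
      rw [Nat.mod_eq_of_lt (by omega)] at this
      omega

theorem DefIso.shell_sdiff_one [IsUltrametricDist K] (hb : UnitPowBijective K l) (hd : 0 < d)
    (hdl : l = d + 1) (hN : ∀ u : K, ‖u‖ = 1 → ‖u ^ d - 1‖ < 1) :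
    DefIso L A (line (shell ϖ (range fun n => d * n)))
      (line (shell ϖ (range fun n => d * n) \ {1})) := by
  have hR := definable_valRing hϖ h (by omega) hb
  have hA := definable_shell (d := d) h hR hd.ne'
  have hH := definable_powShell (d := d) hϖ hR
  have hsub := h.powShell_subset hd.ne'
  have hH1 := h.powShell_eq_union hd.ne' hN
  have hU := h.image_valRing
  set P := shell ϖ (range fun n => d * n)
  set H := powShell ϖ d
  -- Shifting H by ϖ ^ d and fixing the rest frees exactly 1 + ϖR inside P.
  have hC : DefIso L A (line P) (line (P \ H) ∪ line ((fun x => ϖ ^ d * x) '' H)) := by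
    have e : line P = line (P \ H) ∪ line H := by
      change _ = line ((P \ H) ∪ H)
      rw [sdiff_union_of_subset hsub]
    rw [e]
    refine DefIso.union (DefIso.refl (hA.sdiff hH)) (DefIso.of_injOn hH (fun {α g} hg => ?_)
      (mul_right_injective₀ (pow_ne_zero d h.ne_zero)).injOn) ?_ ?_
    · have := definableFun_const_of_nullary (α := α) hϖ
      fun_prop
    · exact disjoint_sdiff_left.preimage (fun v : Fin 1 → K => v 0)
    · exact (disjoint_sdiff_left.mono_right (subset_union_left.trans hH1.superset)).preimage
        (fun v : Fin 1 → K => v 0)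
  have hinj : Function.Injective fun t : K => 1 + ϖ * t :=
    (add_right_injective 1).comp (mul_right_injective₀ h.ne_zero)
  have huniv : A.Definable L (line (shell ϖ univ)) := by
    rw [h.shell_univ]
    exact hR.sdiff (Set.DefinableFun.ofPred_eq (f := fun v : Fin 1 → K => v 0) (g := fun _ => 0)
      (by fun_prop) (by fun_prop))
  have hW : DefIso L A (line (shell ϖ univ)) (line ({x : K | ‖x - 1‖ < 1} \ {1})) := by
    have e : {x : K | ‖x - 1‖ < 1} \ {1} = (fun t => 1 + ϖ * t) '' shell ϖ univ := by
      rw [h.shell_univ, image_sdiff hinj, hU]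
      simp
    rw [e]
    refine DefIso.of_injOn huniv (fun {α g} hg => ?_) hinj.injOn
    have := definableFun_const_of_nullary (α := α) hϖ
    fun_prop
  have hl := DefIso.shell_mul h hb (by omega : l ≠ 0) hA
  have hQ := DefIso.shell_univ hϖ h hb hd hdl hA
  have hle : shell ϖ ((fun n => l * n) '' range fun n => d * n) ⊆ P := by
    rintro x ⟨_, ⟨_, ⟨n, rfl⟩, rfl⟩, hx⟩
    exact ⟨_, ⟨l * n, rfl⟩, hx.trans (by simp only [mul_left_comm])⟩
  rw [h.shell_sdiff] at hQ
  set Pl := shell ϖ ((fun n => l * n) '' range fun n => d * n)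
  have hdisj := h.powShell_disjoint hd.ne'
  -- Pl ≅ P fills P outside 1 + ϖR, while P \ Pl ≅ R \ {0} fills 1 + ϖR except for the point 1.
  have key := DefIso.union (hl.symm.trans hC) (hQ.symm.trans hW)
    (disjoint_sdiff_right.preimage (fun v : Fin 1 → K => v 0))
    (X' := line ((P \ H) ∪ (fun x => ϖ ^ d * x) '' H))
    ((disjoint_union_left.mpr
      ⟨disjoint_sdiff_left.mono_right (subset_union_right.trans hH1.superset), hdisj⟩ |>.mono_right
        sdiff_subset).preimage (fun v : Fin 1 → K => v 0))
  have e1 : line Pl ∪ line (P \ Pl) = line P :=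
    congrArg line (union_sdiff_cancel hle)
  have e2 : line ((P \ H) ∪ (fun x => ϖ ^ d * x) '' H) ∪ line ({x : K | ‖x - 1‖ < 1} \ {1}) =
      line (P \ {1}) := by
    refine congrArg line
      (a₁ := (P \ H) ∪ (fun x => ϖ ^ d * x) '' H ∪ ({x : K | ‖x - 1‖ < 1} \ {1})) ?_
    have h1 : (1 : K) ∉ (P \ H) ∪ (fun x => ϖ ^ d * x) '' H := by
      have h2 : (1 : K) ∈ {x : K | ‖x - 1‖ < 1} := by simp
      rintro (h3 | h3)
      · exact h3.2 (hH1.superset (Or.inr h2))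
      · exact disjoint_left.mp hdisj h3 h2
    rw [← sdiff_singleton_eq_self h1, ← union_sdiff_distrib, union_assoc, ← hH1,
      sdiff_union_of_subset hsub]
  rwa [e1, e2] at key

theorem DefIso.valRing_sdiff_zero [IsUltrametricDist K] (hb : UnitPowBijective K l) (hd : 0 < d)
    (hdl : l = d + 1) (hN : ∀ u : K, ‖u‖ = 1 → ‖u ^ d - 1‖ < 1) :
    DefIso L A (line {x : K | ‖x‖ ≤ 1}) (line ({x : K | ‖x‖ ≤ 1} \ {0})) := by
  have hR := definable_valRing hϖ h (by omega) hb
  have hA := definable_shell (d := d) h hR hd.ne'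
  have h1 := DefIso.shell_sdiff_one hϖ h hb hd hdl hN
  have hone : (1 : K) ∈ shell ϖ (range fun n => d * n) := ⟨0, ⟨0, by simp⟩, by simp⟩
  have hsub : shell ϖ (range fun n => d * n) ⊆ {x : K | ‖x‖ ≤ 1} \ {0} := by
    rw [← h.shell_univ, ← union_univ (range fun n => d * n), shell_union]
    exact subset_union_left
  set P := shell ϖ (range fun n => d * n)
  have h0 : A.Definable L (line ({0} : Set K)) :=
    Set.DefinableFun.ofPred_eq (f := fun v : Fin 1 → K => v 0) (g := fun _ => 0)
      (by fun_prop) (by fun_prop)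
  have h01 : DefIso L A (line ({0} : Set K)) (line ({1} : Set K)) := by
    have e : ({1} : Set K) = (fun x => 1 + x) '' {0} := by simp
    rw [e]
    exact DefIso.of_injOn h0 (fun hg => by fun_prop) (add_right_injective 1).injOn
  -- P contracts onto P \ {1} and 0 takes the place of 1; the remaining nonzero elements of R stay
  -- fixed.
  have h2 := DefIso.union h1 h01
    ((disjoint_singleton_right.mpr fun h3 => (hsub h3).2 rfl).preimage (fun v : Fin 1 → K => v 0))
    (disjoint_sdiff_left.preimage (fun v : Fin 1 → K => v 0))
  have hrest : A.Definable L (line (({x : K | ‖x‖ ≤ 1} \ {0}) \ P)) := (hR.sdiff h0).sdiff hA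
  have h3 := DefIso.union h2 (DefIso.refl hrest)
    (Disjoint.preimage (fun v : Fin 1 → K => v 0) (s := P ∪ {0}) (disjoint_left.mpr (by
      rintro x (hx | hx) hx'
      · exact hx'.2 hx
      · exact hx'.1.2 hx)))
    (Disjoint.preimage (fun v : Fin 1 → K => v 0) (s := P \ {1} ∪ {1}) (disjoint_left.mpr (by
      rintro x hx hx'
      rw [sdiff_union_of_subset (singleton_subset_iff.mpr hone)] at hx
      exact hx'.2 hx)))
  have e1 : line P ∪ line {0} ∪ line (({x : K | ‖x‖ ≤ 1} \ {0}) \ P) = line {x : K | ‖x‖ ≤ 1} := by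
    refine congrArg line (a₁ := P ∪ {0} ∪ (({x : K | ‖x‖ ≤ 1} \ {0}) \ P)) ?_
    rw [union_right_comm, union_sdiff_cancel hsub, sdiff_union_of_subset (by simp)]
  have e2 : line (P \ {1}) ∪ line {1} ∪ line (({x : K | ‖x‖ ≤ 1} \ {0}) \ P) =
      line ({x : K | ‖x‖ ≤ 1} \ {0}) := by
    refine congrArg line (a₁ := P \ {1} ∪ {1} ∪ (({x : K | ‖x‖ ≤ 1} \ {0}) \ P)) ?_
    rw [sdiff_union_of_subset (singleton_subset_iff.mpr hone), union_sdiff_cancel hsub]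
  rwa [e1, e2] at h3

end ShellDefinable

/-! ### Finite extensions of the p-adic numbers -/

theorem IsUniformizer.definable_and_defIso {p : ℕ} [Fact p.Prime] {K : Type w} [Field K]
    [Algebra ℚ_[p] K] [FiniteDimensional ℚ_[p] K] {ϖ : K} (hϖ : IsUniformizer p K ϖ) (A : Set K) :
    letI : ringPi.Structure K := ringPiStructure K ϖ
    A.Definable ringPi (line (valRing p K)) ∧
      DefIso ringPi A (line (valRing p K)) (line (valRing p K \ {0})) := by
  let : NontriviallyNormedField K := spectralNorm.nontriviallyNormedField ℚ_[p] K
  let : NormedAlgebra ℚ_[p] K := spectralNorm.normedAlgebra ℚ_[p] K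
  have : IsUltrametricDist K :=
    IsUltrametricDist.isUltrametricDist_of_isNonarchimedean_norm isNonarchimedean_spectralNorm
  have : ProperSpace K := FiniteDimensional.proper ℚ_[p] K
  let : ringPi.Structure K := ringPiStructure K ϖ
  have := definableRing_ringPi ϖ A
  have hc := definableFun_uniformizer ϖ A
  have h : NormUniformizer ϖ := by
    obtain ⟨h0, ⟨x, hx, hx1⟩, hmax⟩ := hϖ
    exact ⟨h0, hx1, fun x hx => hmax ⟨x, rfl, hx⟩⟩
  have hp1 := (Fact.out : p.Prime).one_lt
  have hp : ‖(p : K)‖ < 1 := by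
    rw [← map_natCast (algebraMap ℚ_[p] K), norm_algebraMap']
    exact Padic.norm_p_lt_one
  obtain ⟨N, hN0, hN⟩ := exists_pow_sub_one_lt K
  -- The factor p in d = p * N makes l = d + 1 prime to p as well as to N.
  have hb : UnitPowBijective K (p * N + 1) :=
    unitPowBijective hp hp1 hN0 hN (by simp) (by simp) (Nat.succ_ne_zero _)
  have hd : 0 < p * N := Nat.mul_pos (by omega) hN0
  have hN' : ∀ u : K, ‖u‖ = 1 → ‖u ^ (p * N) - 1‖ < 1 := fun u hu => by
    rw [pow_mul]
    exact hN _ (by simp [hu])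
  exact ⟨definable_valRing hc h (by omega) hb, DefIso.valRing_sdiff_zero hc h hb hd rfl hN'⟩

end DefinableGrothendieck

open DefinableGrothendieck in
theorem mainTheorem5 (p : ℕ) [Fact p.Prime] (K : Type w) [Field K] [Algebra ℚ_[p] K]
    [FiniteDimensional ℚ_[p] K] (ϖ : K) (hϖ : DefinableGrothendieck.IsUniformizer p K ϖ)
    (A : Set K) :
    letI : DefinableGrothendieck.ringPi.Structure K := DefinableGrothendieck.ringPiStructure K ϖ
    Subsingleton (DefinableGrothendieck.GrothendieckRing DefinableGrothendieck.ringPi A) ∧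
      DefinableGrothendieck.DefIso DefinableGrothendieck.ringPi A
        (DefinableGrothendieck.line (DefinableGrothendieck.valRing p K))
        (DefinableGrothendieck.line (DefinableGrothendieck.valRing p K \ {0})) := by
  let : ringPi.Structure K := ringPiStructure K ϖ
  obtain ⟨hR, hiso⟩ := hϖ.definable_and_defIso A
  have := definableRing_ringPi ϖ A
  have e : line ({0} : Set K) = {fun _ => 0} := by
    ext v
    simp [line, funext_iff]
  have h0 : A.Definable ringPi (line ({0} : Set K)) :=
    Set.DefinableFun.ofPred_eq (f := fun v : Fin 1 → K => v 0) (g := fun _ => 0)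
      (by fun_prop) (by fun_prop)
  refine ⟨subsingleton_grothendieckRing one_pos (X := line (valRing p K)) (fun _ => 0) ?_ hR
    (e ▸ h0) ?_, hiso⟩
  · change spectralNorm ℚ_[p] K 0 ≤ 1
    rw [spectralNorm_zero]
    exact zero_le_one
  · rw [← e]
    exact hiso
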